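/- Let $m,n$ be natural numbers, $Z\in\mathbb{R}^{m\times n}$, $\epsilon>0$ and $\lambda>0$, and write $m\wedge n=\min\{m,n\}$. For $X\in\mathbb{R}^{m\times n}$ let $\sigma(X)=(\sigma_1(X),\dots,\sigma_{m\wedge n}(X))$ be the vector of singular values of $X$ in decreasing order. For $x\in\mathbb{R}^{k}$ put $f(x)=\sum_{i=1}^{k}\log(1+|x_i|/\epsilon)$, and for $w\in\mathbb{R}$ put $g(w)=\log(1+|w|/\epsilon)$. For a real function $F$ on a Euclidean space ($\mathbb{R}^{m\times n}$ carrying the Frobenius norm) let $\mathrm{prox}_{\lambda F}(z)$ be the set of all global minimizers $w$ of $\frac{1}{2\lambda}\|w-z\|^2+F(w)$. For $x\in\mathbb{R}^{m\wedge n}$ let $\mathrm{Diag}(x)$ be the $m\times n$ matrix with $(i,i)$ entries $x_i$ and all other entries $0$, and let $$\mathcal{O}(Z)=\{(U,V)\in\mathbb{R}^{m\times m}\times\mathbb{R}^{n\times n}: U^\top U=I,\ V^\top V=I,\ Z=U\,\mathrm{Diag}(\sigma(Z))\,V^\top\}.$$ Then $\mathrm{prox}_{\lambda f\circ\sigma}(Z)$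 is exactly the set of global minimizers over $X\in\mathbb{R}^{m\times n}$ of $$\frac{1}{2\lambda}\|X-Z\|_F^2+\sum_{i=1}^{m\wedge n}\log\Big(1+\frac{\sigma_i(X)}{\epsilon}\Big).$$ Moreover, if $X^\star\in\mathrm{prox}_{\lambda f\circ\sigma}(Z)$, then there exist a pair $(U,V)\in\mathcal{O}(Z)$ and a vector $d\in\mathrm{prox}_{\lambda f}(\sigma(Z))$, with $d_i\in\mathrm{prox}_{\lambda g}(\sigma_i(Z))$ for every $i$, such that $X^\star=U\,\mathrm{Diag}(d)\,V^\top$. Conversely, for every $(U,V)\in\mathcal{O}(Z)$ and every $d\in\mathrm{prox}_{\lambda f}(\sigma(Z))$, the matrix $U\,\mathrm{Diag}(d)\,V^\top$ belongs to $\mathrm{prox}_{\lambda f\circ\sigma}(Z)$. -/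

import Mathlib

/-! The space of `m × n` real matrices carries the Frobenius norm
(the norm of the inner product `tr (Xᵀ Y)`). -/

attribute [local instance] Matrix.frobeniusNormedAddCommGroup

namespace LogSum

/-- The (set-valued) proximity operator of `F` with index `lam` at `z`:
the set of global minimizers of `w ↦ ‖w - z‖² / (2 lam) + F w`. -/
def prox {E : Type*} [NormedAddCommGroup E] (lam : ℝ) (F : E → ℝ) (z : E) : Set E :=
  {w | ∀ v : E, 1 / (2 * lam) * ‖w - z‖ ^ 2 + F w ≤ 1 / (2 * lam) * ‖v - z‖ ^ 2 + F v}

/-- The scalar log-sum penalty `g(w) = log (1 + |w| / ε)`. -/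
noncomputable def g (ε : ℝ) (w : ℝ) : ℝ := Real.log (1 + |w| / ε)

/-- The log-sum penalty `f(x) = ∑ᵢ log (1 + |xᵢ| / ε)` on `ℝᵏ`. -/
noncomputable def f (ε : ℝ) {k : ℕ} (x : EuclideanSpace ℝ (Fin k)) : ℝ :=
  ∑ i, Real.log (1 + |x i| / ε)

/-- The vector `σ(X)` of the `min m n` singular values of an `m × n` matrix,
in decreasing order and with multiplicity. -/
noncomputable def sigma {m n : ℕ} (X : Matrix (Fin m) (Fin n) ℝ) :
    EuclideanSpace ℝ (Fin (min m n)) :=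
  WithLp.toLp 2 fun i => (Matrix.toEuclideanLin X).singularValues (i : ℕ)

/-- The `m × n` matrix with `(i, i)` entry `x i` and all off-diagonal entries zero. -/
def Diag {m n : ℕ} (x : EuclideanSpace ℝ (Fin (min m n))) : Matrix (Fin m) (Fin n) ℝ :=
  Matrix.of fun i j =>
    if h : (i : ℕ) = (j : ℕ) then x ⟨i, lt_min i.isLt (h ▸ j.isLt)⟩ else 0

/-- The pairs `(U, V)` of orthogonal matrices for which `X = U Diag(σ(X)) Vᵀ` is a
singular value decomposition of `X`. -/
def svdPairs {m n : ℕ} (X : Matrix (Fin m) (Fin n) ℝ) :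
    Set (Matrix (Fin m) (Fin m) ℝ × Matrix (Fin n) (Fin n) ℝ) :=
  {P | P.1.transpose * P.1 = 1 ∧ P.2.transpose * P.2 = 1 ∧
    X = P.1 * Diag (sigma X) * P.2.transpose}

/-- The objective `‖X - Z‖_F² / (2 lam) + ∑ᵢ log (1 + σᵢ(X) / ε)` of the low-rank problem,
with the squared Frobenius norm written out as a sum of squared entries. -/
noncomputable def lowRankObjective {m n : ℕ} (ε lam : ℝ) (Z X : Matrix (Fin m) (Fin n) ℝ) : ℝ :=
  1 / (2 * lam) * (∑ i, ∑ j, (X i j - Z i j) ^ 2) + ∑ i, Real.log (1 + sigma X i / ε)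

end LogSum

/-! Two facts reduce the matrix problem to the vector problem. Singular values are nonexpansive,
`‖σ(X) - σ(Z)‖ ≤ ‖X - Z‖`, which is von Neumann's trace inequality `frob_le_sum_sigma` after
expanding squares. And for `(U, V)` in `svdPairs Z`, `U Diag(v) Vᵀ` lies at distance `‖v - σ(Z)‖`
from `Z` with penalty `f v`. So any vector minimizer lifts to a matrix minimizer.

Conversely, a minimizer `X` is at least as close to `Z` as `U Diag(σ(X)) Vᵀ`, which has the same
penalty. This forces equality in the trace inequality, so `X` and `Z` share a singular value
decomposition by `exists_mem_svdPairs_inter_of_le_frob`. -/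

namespace LogSum

open Matrix

/-! ### Rearrangement for substochastic matrices -/

/-- A doubly substochastic matrix pairs two nonnegative antitone vectors below their dot product. -/
theorem sum_substochastic_mul_le {k : ℕ} (D : Matrix (Fin k) (Fin k) ℝ) (hD : ∀ i j, 0 ≤ D i j)
    (hr : ∀ i, ∑ j, D i j ≤ 1) (hc : ∀ j, ∑ i, D i j ≤ 1) {x y : Fin k → ℝ}
    (hx : Antitone x) (hy : Antitone y) (hx0 : ∀ i, 0 ≤ x i) (hy0 : ∀ i, 0 ≤ y i) :
    ∑ i, ∑ j, D i j * (x i * y j) ≤ ∑ i, x i * y i := by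
  -- Dilation to a doubly stochastic matrix: the diagonal blocks `1 - row sum` and `1 - column sum`
  -- absorb the slack, and padding `x`, `y` by zeros keeps them out of the pairing. Birkhoff's
  -- theorem then leaves only permutations.
  let E : Matrix (Fin k ⊕ Fin k) (Fin k ⊕ Fin k) ℝ :=
    fromBlocks D (diagonal fun i => 1 - ∑ j, D i j) (diagonal fun j => 1 - ∑ i, D i j) Dᵀ
  have hE : E ∈ doublyStochastic ℝ (Fin k ⊕ Fin k) := by
    rw [mem_doublyStochastic_iff_sum]
    refine ⟨?_, ?_, ?_⟩
    · rintro (i | i) (j | j)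
      · exact hD i j
      · by_cases h : i = j
        · subst h; simpa [E] using hr i
        · simp [E, h]
      · by_cases h : i = j
        · subst h; simpa [E] using hc i
        · simp [E, h]
      · exact hD j i
    · rintro (i | i) <;> simp [E, diagonal_apply]
    · rintro (i | i) <;> simp [E, diagonal_apply]
  let x' : Fin k ⊕ Fin k → ℝ := Sum.elim x 0
  let y' : Fin k ⊕ Fin k → ℝ := Sum.elim y 0
  have hxy : Monovary x' y' := by
    rintro (i | i) (j | j) h
    · exact hx (not_lt.1 fun hij => absurd h (not_lt.2 (hy hij.le)))
    · exact absurd h (not_lt.2 (hy0 i))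
    · exact hx0 j
    · exact le_rfl
  obtain ⟨w, hw0, hw1, hw⟩ := exists_eq_sum_perm_of_mem_doublyStochastic hE
  have h1 : ∑ i, ∑ j, D i j * (x i * y j) = ∑ i, ∑ j, E i j * (x' i * y' j) := by
    simp [E, x', y']
  have h2 : ∑ i, x i * y i = ∑ i, x' i * y' i := by simp [x', y']
  rw [h1, h2, ← hw]
  have h3 : ∀ i j, (∑ s, w s • Equiv.Perm.permMatrix ℝ s) i j * (x' i * y' j)
      = ∑ s, w s * ((Equiv.Perm.permMatrix ℝ s) i j * (x' i * y' j)) := by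
    intro i j
    rw [Matrix.sum_apply, Finset.sum_mul]
    exact Finset.sum_congr rfl fun s _ => by simp
  calc ∑ i, ∑ j, (∑ s, w s • Equiv.Perm.permMatrix ℝ s) i j * (x' i * y' j)
      = ∑ s, w s * ∑ i, x' i * y' (s i) := by
        simp_rw [h3]
        rw [Finset.sum_congr rfl fun i _ => Finset.sum_comm, Finset.sum_comm]
        refine Finset.sum_congr rfl fun s _ => ?_
        rw [Finset.mul_sum]
        refine Finset.sum_congr rfl fun i _ => ?_
        rw [← Finset.mul_sum]
        simp [Equiv.Perm.permMatrix, PEquiv.toMatrix_apply, eq_comm]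
    _ ≤ ∑ s, w s * ∑ i, x' i * y' i :=
        Finset.sum_le_sum fun s _ =>
          mul_le_mul_of_nonneg_left hxy.sum_mul_comp_perm_le_sum_mul (hw0 s)
    _ = ∑ i, x' i * y' i := by rw [← Finset.sum_mul, hw1, one_mul]

/-! ### Frobenius inner product -/

/-- The Frobenius inner product. -/
def frob {m n : ℕ} (A B : Matrix (Fin m) (Fin n) ℝ) : ℝ := ∑ i, ∑ j, A i j * B i j

section frob

variable {m n : ℕ} (A B C : Matrix (Fin m) (Fin n) ℝ)

theorem frob_add_left : frob (A + B) C = frob A C + frob B C := by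
  simp [frob, add_mul, Finset.sum_add_distrib]

theorem frob_sub_left : frob (A - B) C = frob A C - frob B C := by
  simp [frob, sub_mul, Finset.sum_sub_distrib]

theorem frob_comm : frob A B = frob B A := by simp [frob, mul_comm]

theorem frob_add_right : frob C (A + B) = frob C A + frob C B := by
  rw [frob_comm, frob_add_left, frob_comm A, frob_comm B]

theorem frob_sub_right : frob C (A - B) = frob C A - frob C B := by
  rw [frob_comm, frob_sub_left, frob_comm A, frob_comm B]

theorem frob_self_sub : frob (A - B) (A - B) = frob A A - 2 * frob A B + frob B B := by
  rw [frob_sub_left, frob_sub_right, frob_sub_right, frob_comm B A]; ring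

theorem frob_self_eq_sum_sq : frob A A = ∑ i, ∑ j, A i j ^ 2 := by simp [frob, sq]

theorem norm_sq_eq_frob : ‖A‖ ^ 2 = frob A A := by
  rw [frobenius_norm_def, ← Real.sqrt_eq_rpow, Real.sq_sqrt (by positivity), frob_self_eq_sum_sq]
  simp

theorem eq_zero_of_frob_self_nonpos (h : frob A A ≤ 0) : A = 0 := by
  rw [← norm_sq_eq_frob] at h
  exact norm_eq_zero.1 (pow_eq_zero_iff two_ne_zero |>.1 (le_antisymm h (sq_nonneg _)))

theorem frob_eq_trace : frob A B = trace (Aᵀ * B) := by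
  simp only [frob, trace, diag_apply, mul_apply, transpose_apply]
  exact Finset.sum_comm

theorem frob_orthogonal {U : Matrix (Fin m) (Fin m) ℝ} {V : Matrix (Fin n) (Fin n) ℝ}
    (hU : Uᵀ * U = 1) (hV : Vᵀ * V = 1) : frob (U * A * Vᵀ) (U * B * Vᵀ) = frob A B := by
  rw [frob_eq_trace, frob_eq_trace]
  have : (U * A * Vᵀ)ᵀ * (U * B * Vᵀ) = V * (Aᵀ * B * Vᵀ) := by
    simp only [transpose_mul, transpose_transpose, Matrix.mul_assoc]
    rw [← Matrix.mul_assoc Uᵀ, hU, Matrix.one_mul]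
  rw [this, trace_mul_comm, Matrix.mul_assoc, hV, Matrix.mul_one]

end frob

/-! ### Diagonal matrices and von Neumann's trace inequality -/

section Diag

variable {m n : ℕ}

theorem Diag_add (x y : EuclideanSpace ℝ (Fin (min m n))) :
    (Diag (x + y) : Matrix (Fin m) (Fin n) ℝ) = Diag x + Diag y := by
  ext i j
  by_cases h : (i : ℕ) = j <;> simp [Diag, h]

theorem Diag_sub (x y : EuclideanSpace ℝ (Fin (min m n))) :
    (Diag (x - y) : Matrix (Fin m) (Fin n) ℝ) = Diag x - Diag y := by
  ext i j
  by_cases h : (i : ℕ) = j <;> simp [Diag, h]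

/-- The Frobenius inner product with a diagonal matrix is summation along the diagonal. -/
theorem frob_Diag_left (x : EuclideanSpace ℝ (Fin (min m n))) (F : Matrix (Fin m) (Fin n) ℝ) :
    frob (Diag x) F =
      ∑ k, x k * F (k.castLE (min_le_left m n)) (k.castLE (min_le_right m n)) := by
  rw [frob, ← Fintype.sum_prod_type']
  symm
  apply Finset.sum_of_injOn
    (fun k : Fin (min m n) => (k.castLE (min_le_left m n), k.castLE (min_le_right m n)))
  · intro a _ b _ h
    simpa [Fin.ext_iff] using h
  · simp
  · rintro ⟨i, j⟩ _ h
    have : (i : ℕ) ≠ j := by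
      intro hij
      refine h ⟨⟨i, lt_min i.isLt (hij ▸ j.isLt)⟩, by simp, ?_⟩
      ext <;> simp [hij]
    simp [Diag, this]
  · intro k _
    simp [Diag]

theorem frob_Diag_Diag (x y : EuclideanSpace ℝ (Fin (min m n))) :
    frob (Diag x : Matrix (Fin m) (Fin n) ℝ) (Diag y) = ∑ k, x k * y k := by
  rw [frob_Diag_left]
  simp [Diag]

theorem mul_Diag_mul_apply (P : Matrix (Fin m) (Fin m) ℝ) (Q : Matrix (Fin n) (Fin n) ℝ)
    (x : EuclideanSpace ℝ (Fin (min m n))) (a : Fin m) (b : Fin n) :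
    (P * Diag x * Qᵀ) a b =
      ∑ k, x k * (P a (k.castLE (min_le_left m n)) * Q b (k.castLE (min_le_right m n))) := by
  have h := frob_Diag_left x (Matrix.of fun i j => P a i * Q b j)
  simp only [of_apply] at h
  rw [← h, frob, Finset.sum_comm]
  simp only [mul_apply, transpose_apply, of_apply, Finset.sum_mul]
  exact Finset.sum_congr rfl fun _ _ => Finset.sum_congr rfl fun _ _ => by ring

theorem sum_sq_row_castLE_le {l k : ℕ} (h : k ≤ l) {P : Matrix (Fin l) (Fin l) ℝ}
    (hP : P * Pᵀ = 1) (i : Fin l) : ∑ j : Fin k, P i (j.castLE h) ^ 2 ≤ 1 := by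
  have h1 : ∑ j, P i j ^ 2 = 1 := by
    have := congrFun (congrFun hP i) i
    simpa [mul_apply, sq] using this
  rw [← h1, ← Finset.sum_image (s := Finset.univ) (g := Fin.castLE h) (f := fun j => P i j ^ 2)
    (fun a _ b _ hab => Fin.castLE_injective h hab)]
  exact Finset.sum_le_sum_of_subset_of_nonneg (Finset.subset_univ _) fun _ _ _ => sq_nonneg _

/-- Von Neumann's trace inequality against a diagonal matrix. -/
theorem frob_orthogonal_Diag_le {P : Matrix (Fin m) (Fin m) ℝ} {Q : Matrix (Fin n) (Fin n) ℝ}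
    (hP : Pᵀ * P = 1) (hQ : Qᵀ * Q = 1) {x y : EuclideanSpace ℝ (Fin (min m n))}
    (hx : Antitone x) (hy : Antitone y) (hx0 : ∀ i, 0 ≤ x i) (hy0 : ∀ i, 0 ≤ y i) :
    frob (P * Diag x * Qᵀ) (Diag y) ≤ ∑ k, x k * y k := by
  have hP' : P * Pᵀ = 1 := mul_eq_one_comm.1 hP
  have hQ' : Q * Qᵀ = 1 := mul_eq_one_comm.1 hQ
  let ι : Fin (min m n) → Fin m := Fin.castLE (min_le_left m n)
  let κ : Fin (min m n) → Fin n := Fin.castLE (min_le_right m n)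
  -- By AM-GM these averaged squares dominate the products `P * Q` in the trace; truncated rows and
  -- columns of orthogonal matrices make `D` substochastic.
  let D : Matrix (Fin (min m n)) (Fin (min m n)) ℝ :=
    Matrix.of fun j i => (P (ι i) (ι j) ^ 2 + Q (κ i) (κ j) ^ 2) / 2
  have hD := sum_substochastic_mul_le D (fun i j => by simp only [D, of_apply]; positivity) ?_ ?_
    hx hy hx0 hy0
  · refine le_trans ?_ hD
    rw [frob_comm, frob_Diag_left]
    simp only [mul_Diag_mul_apply, Finset.mul_sum]
    rw [Finset.sum_comm]
    refine Finset.sum_le_sum fun j _ => Finset.sum_le_sum fun i _ => ?_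
    have h1 := mul_nonneg (hx0 j) (hy0 i)
    have h2 : P (ι i) (ι j) * Q (κ i) (κ j) ≤ D j i := by
      simp only [D, of_apply]
      linarith [two_mul_le_add_sq (P (ι i) (ι j)) (Q (κ i) (κ j))]
    calc _ = P (ι i) (ι j) * Q (κ i) (κ j) * (x j * y i) := by ring
      _ ≤ _ := mul_le_mul_of_nonneg_right h2 h1
  · intro j
    have h1 := sum_sq_row_castLE_le (min_le_left m n) (P := Pᵀ) (by simpa using hP) (ι j)
    have h2 := sum_sq_row_castLE_le (min_le_right m n) (P := Qᵀ) (by simpa using hQ) (κ j)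
    simp only [transpose_apply] at h1 h2
    simp only [D, of_apply, ← Finset.sum_div, Finset.sum_add_distrib]
    linarith
  · intro i
    have h1 := sum_sq_row_castLE_le (min_le_left m n) hP' (ι i)
    have h2 := sum_sq_row_castLE_le (min_le_right m n) hQ' (κ i)
    simp only [D, of_apply, ← Finset.sum_div, Finset.sum_add_distrib]
    linarith

/-- Von Neumann's trace inequality for two singular value decompositions. -/
theorem frob_le_of_svd {U P : Matrix (Fin m) (Fin m) ℝ} {V Q : Matrix (Fin n) (Fin n) ℝ}
    (hU : Uᵀ * U = 1) (hV : Vᵀ * V = 1) (hP : Pᵀ * P = 1) (hQ : Qᵀ * Q = 1)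
    {x y : EuclideanSpace ℝ (Fin (min m n))}
    (hx : Antitone x) (hy : Antitone y) (hx0 : ∀ i, 0 ≤ x i) (hy0 : ∀ i, 0 ≤ y i) :
    frob (P * Diag x * Qᵀ) (U * Diag y * Vᵀ) ≤ ∑ k, x k * y k := by
  have hU' : U * Uᵀ = 1 := mul_eq_one_comm.1 hU
  have hV' : V * Vᵀ = 1 := mul_eq_one_comm.1 hV
  have h : P * Diag x * Qᵀ = U * ((Uᵀ * P) * Diag x * (Vᵀ * Q)ᵀ) * Vᵀ := by
    simp only [transpose_mul, transpose_transpose, Matrix.mul_assoc, hV', Matrix.mul_one]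
    simp only [← Matrix.mul_assoc, hU', Matrix.one_mul]
  rw [h, frob_orthogonal _ _ hU hV]
  refine frob_orthogonal_Diag_le ?_ ?_ hx hy hx0 hy0
  · rw [transpose_mul, transpose_transpose, Matrix.mul_assoc, ← Matrix.mul_assoc U, hU',
      Matrix.one_mul, hP]
  · rw [transpose_mul, transpose_transpose, Matrix.mul_assoc, ← Matrix.mul_assoc V, hV',
      Matrix.one_mul, hQ]

end Diag

/-! ### Singular value decompositions and the equality case -/

section svd

variable {m n : ℕ}

theorem Diag_transpose_mul_Diag (x : EuclideanSpace ℝ (Fin (min m n))) :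
    (Diag x : Matrix (Fin m) (Fin n) ℝ)ᵀ * Diag x =
      diagonal fun j : Fin n => if h : (j : ℕ) < min m n then x ⟨j, h⟩ ^ 2 else 0 := by
  ext j l
  rw [mul_apply]
  by_cases hj : (j : ℕ) < min m n
  · rw [Finset.sum_eq_single (⟨j, hj.trans_le (min_le_left m n)⟩ : Fin m)]
    · by_cases h : j = l
      · subst h
        simp [Diag, lt_min_iff.1 hj, sq]
      · simp [Diag, h, Fin.ext_iff.not.1 h]
    · intro i _ hi
      have : (i : ℕ) ≠ j := fun h => hi (Fin.ext h)
      simp [Diag, this]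
    · simp
  · have h0 : ∀ i : Fin m, (i : ℕ) ≠ j := fun i hi => hj (lt_min (hi ▸ i.isLt) j.isLt)
    rw [Finset.sum_eq_zero fun i _ => by simp [Diag, h0 i]]
    by_cases h : j = l
    · subst h
      rw [diagonal_apply_eq, dif_neg hj]
    · simp [h]

theorem sum_dite_castLE {k l : ℕ} (h : k ≤ l) (x : Fin k → ℝ) {φ : ℝ → ℝ} (hφ : φ 0 = 0) :
    ∑ j : Fin l, φ (if h : (j : ℕ) < k then x ⟨j, h⟩ else 0) = ∑ i, φ (x i) := by
  symm
  apply Finset.sum_of_injOn (Fin.castLE h)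
  · exact fun a _ b _ hab => Fin.castLE_injective h hab
  · simp
  · intro j _ hj
    have : ¬ (j : ℕ) < k := fun hjk => hj ⟨⟨j, hjk⟩, by simp, by ext; simp⟩
    simp [this, hφ]
  · intro i _
    simp

theorem roots_charpoly_diagonal {l : ℕ} (d : Fin l → ℝ) :
    (diagonal d).charpoly.roots = Finset.univ.val.map d := by
  have h := Polynomial.roots_multiset_prod_X_sub_C (Finset.univ.val.map d)
  rw [Multiset.map_map] at h
  rw [charpoly_diagonal]
  exact h

/-- Two signed singular value decompositions of the same matrix have the same squared diagonal
entries up to order. -/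
theorem sum_sq_eq_of_orthogonal_Diag_eq {U P : Matrix (Fin m) (Fin m) ℝ}
    {V Q : Matrix (Fin n) (Fin n) ℝ}
    (hU : Uᵀ * U = 1) (hV : Vᵀ * V = 1) (hP : Pᵀ * P = 1) (hQ : Qᵀ * Q = 1)
    {x y : EuclideanSpace ℝ (Fin (min m n))} (h : U * Diag x * Vᵀ = P * Diag y * Qᵀ)
    {φ : ℝ → ℝ} (hφ : φ 0 = 0) : ∑ i, φ (x i ^ 2) = ∑ i, φ (y i ^ 2) := by
  have key : ∀ {U : Matrix (Fin m) (Fin m) ℝ} {V : Matrix (Fin n) (Fin n) ℝ}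
      (x : EuclideanSpace ℝ (Fin (min m n))), Uᵀ * U = 1 → Vᵀ * V = 1 →
      (((U * Diag x * Vᵀ)ᵀ * (U * Diag x * Vᵀ)).charpoly.roots.map φ).sum = ∑ i, φ (x i ^ 2) := by
    intro U V x hU hV
    -- The Gram matrix is orthogonally similar to `(Diag x)ᵀ * Diag x`, so its characteristic roots
    -- are the squares `x i ^ 2` padded with zeros, which `φ 0 = 0` discards.
    have h1 : (U * Diag x * Vᵀ)ᵀ * (U * Diag x * Vᵀ) = V * ((Diag x)ᵀ * Diag x * Vᵀ) := by
      simp only [transpose_mul, transpose_transpose, Matrix.mul_assoc]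
      rw [← Matrix.mul_assoc Uᵀ, hU, Matrix.one_mul]
    rw [h1, charpoly_mul_comm, Matrix.mul_assoc, hV, Matrix.mul_one, Diag_transpose_mul_Diag,
      roots_charpoly_diagonal, Multiset.map_map]
    exact sum_dite_castLE (min_le_right m n) (fun i => x i ^ 2) hφ
  rw [← key x hU hV, ← key y hP hQ, h]

theorem sigma_nonneg (X : Matrix (Fin m) (Fin n) ℝ) (i : Fin (min m n)) : 0 ≤ sigma X i :=
  (toEuclideanLin X).singularValues_nonneg i

theorem sigma_antitone (X : Matrix (Fin m) (Fin n) ℝ) : Antitone (sigma X) :=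
  fun _ _ h => (toEuclideanLin X).singularValues_antitone h

theorem orthonormalBasis_transpose_mul_self {l : ℕ}
    (b : OrthonormalBasis (Fin l) ℝ (EuclideanSpace ℝ (Fin l))) :
    (Matrix.of fun i j => b j i)ᵀ * (Matrix.of fun i j => b j i) = (1 : Matrix _ _ ℝ) := by
  ext j l
  have := orthonormal_iff_ite.1 b.orthonormal j l
  simp only [PiLp.inner_apply, RCLike.inner_apply, conj_trivial] at this
  simp only [mul_apply, transpose_apply, of_apply, one_apply, ← this]
  exact Finset.sum_congr rfl fun _ _ => mul_comm _ _

/-- Every real matrix has a singular value decomposition. -/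
theorem svdPairs_nonempty (X : Matrix (Fin m) (Fin n) ℝ) : (svdPairs X).Nonempty := by
  let T := toEuclideanLin X
  have hT := T.isSymmetric_adjoint_comp_self
  have hn : Module.finrank ℝ (EuclideanSpace ℝ (Fin n)) = n := by simp
  let b := hT.eigenvectorBasis hn
  let s : ℕ → ℝ := T.singularValues
  have hb : ∀ i j, inner ℝ (T (b i)) (T (b j)) = if i = j then s i ^ 2 else 0 := by
    intro i j
    rw [← LinearMap.adjoint_inner_right, ← LinearMap.comp_apply, hT.apply_eigenvectorBasis hn j,
      inner_smul_right, orthonormal_iff_ite.1 b.orthonormal i j,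
      ← LinearMap.sq_singularValues_fin]
    by_cases h : i = j
    · subst h; simp [s, T]
    · simp [h]
  have hzero : ∀ j : Fin n, s j = 0 → T (b j) = 0 := by
    intro j hj
    have := hb j j
    rw [if_pos rfl, hj] at this
    exact inner_self_eq_zero.1 (this.trans (by simp))
  have hbig : ∀ j : Fin n, m ≤ j → s j = 0 := by
    intro j hj
    refine (LinearMap.singularValues_eq_zero_iff_le_finrank_range _).2 (le_trans ?_ hj)
    simpa using Submodule.finrank_le (LinearMap.range T)
  -- Left singular vectors. They are orthonormal only on `S`, where the singular value is nonzero;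
  -- the rest of the basis is filled in arbitrarily.
  let v : Fin m → EuclideanSpace ℝ (Fin m) := fun i =>
    if h : (i : ℕ) < n then (s i)⁻¹ • T (b ⟨i, h⟩) else 0
  let S : Set (Fin m) := {i | (i : ℕ) < n ∧ s i ≠ 0}
  have hv : Orthonormal ℝ (S.domRestrict v) := by
    rw [orthonormal_iff_ite]
    rintro ⟨i, hi, hi0⟩ ⟨j, hj, hj0⟩
    simp only [Set.domRestrict_apply, v, hi, hj, dif_pos, inner_smul_left, inner_smul_right, hb,
      Subtype.mk.injEq, Fin.ext_iff]
    by_cases h : (i : ℕ) = j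
    · rw [← h]; simp; field_simp
    · simp [h]
  obtain ⟨c, hc⟩ := hv.exists_orthonormalBasis_extension_of_card_eq (by simp)
  refine ⟨(Matrix.of fun i j => c j i, Matrix.of fun i j => b j i),
    orthonormalBasis_transpose_mul_self c, orthonormalBasis_transpose_mul_self b, ?_⟩
  have hV := mul_eq_one_comm.1 (orthonormalBasis_transpose_mul_self b)
  suffices h : X * (Matrix.of fun i j => b j i) = (Matrix.of fun i j => c j i) * Diag (sigma X) by
    dsimp only
    rw [← h, Matrix.mul_assoc, hV, Matrix.mul_one]
  ext i j
  have h1 : (X * (Matrix.of fun i j => b j i)) i j = T (b j) i := by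
    simp [T, mul_apply, mulVec, dotProduct]
  rw [h1, mul_apply]
  by_cases hj : (j : ℕ) < m
  · rw [Finset.sum_eq_single (⟨j, hj⟩ : Fin m)]
    · have h2 : (Diag (sigma X) : Matrix (Fin m) (Fin n) ℝ) ⟨j, hj⟩ j = s j := by
        simp [Diag, sigma, s, T]
      rw [h2, of_apply]
      by_cases h0 : s j = 0
      · simp [hzero j h0, h0]
      · rw [hc ⟨j, hj⟩ ⟨j.isLt, h0⟩]
        simp only [v, Fin.is_lt, dif_pos, PiLp.smul_apply, smul_eq_mul, Fin.eta]
        field_simp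
    · intro k _ hk
      have : (k : ℕ) ≠ j := fun h => hk (Fin.ext h)
      simp [Diag, this]
    · simp
  · rw [hzero j (hbig j (not_lt.1 hj)), Finset.sum_eq_zero]
    · simp
    · intro k _
      have : (k : ℕ) ≠ j := fun h => hj (h ▸ k.isLt)
      simp [Diag, this]

theorem frob_self_eq_sum_sigma (X : Matrix (Fin m) (Fin n) ℝ) :
    frob X X = ∑ i, sigma X i * sigma X i := by
  obtain ⟨⟨U, V⟩, hU, hV, h⟩ := svdPairs_nonempty X
  calc frob X X = frob (U * Diag (sigma X) * Vᵀ) (U * Diag (sigma X) * Vᵀ) := by rw [← h]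
    _ = _ := by rw [frob_orthogonal _ _ hU hV, frob_Diag_Diag]

theorem frob_le_sum_sigma (X Y : Matrix (Fin m) (Fin n) ℝ) :
    frob X Y ≤ ∑ i, sigma X i * sigma Y i := by
  obtain ⟨⟨U, V⟩, hU, hV, h⟩ := svdPairs_nonempty X
  obtain ⟨⟨P, Q⟩, hP, hQ, h'⟩ := svdPairs_nonempty Y
  calc frob X Y = frob (U * Diag (sigma X) * Vᵀ) (P * Diag (sigma Y) * Qᵀ) := by rw [← h, ← h']
    _ ≤ _ := frob_le_of_svd hP hQ hU hV (sigma_antitone X) (sigma_antitone Y)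
      (sigma_nonneg X) (sigma_nonneg Y)

/-- In the equality case of von Neumann's trace inequality, the two matrices share a singular value
decomposition. -/
theorem exists_mem_svdPairs_inter_of_le_frob {X Y : Matrix (Fin m) (Fin n) ℝ}
    (h : ∑ i, sigma X i * sigma Y i ≤ frob X Y) : (svdPairs X ∩ svdPairs Y).Nonempty := by
  -- A decomposition of the sum will serve both summands.
  obtain ⟨⟨U, V⟩, hU, hV, hW⟩ := svdPairs_nonempty (X + Y)
  dsimp only at hU hV hW
  have hX := frob_le_sum_sigma X (X + Y)
  have hY := frob_le_sum_sigma Y (X + Y)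
  have hs : sigma (X + Y) = sigma X + sigma Y := by
    have h1 : ∑ i, (sigma (X + Y) i - (sigma X i + sigma Y i)) ^ 2 ≤ 0 := by
      have e1 : frob (X + Y) (X + Y) = frob X X + 2 * frob X Y + frob Y Y := by
        rw [frob_add_left, frob_add_right, frob_add_right, frob_comm Y X]; ring
      have e2 := frob_add_left X Y (X + Y)
      have e3 : ∑ i, (sigma (X + Y) i - (sigma X i + sigma Y i)) ^ 2 =
          ∑ i, sigma (X + Y) i * sigma (X + Y) i - 2 * ∑ i, sigma X i * sigma (X + Y) i -
            2 * ∑ i, sigma Y i * sigma (X + Y) i + ∑ i, sigma X i * sigma X i +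
            2 * ∑ i, sigma X i * sigma Y i + ∑ i, sigma Y i * sigma Y i := by
        simp only [Finset.mul_sum, ← Finset.sum_add_distrib, ← Finset.sum_sub_distrib]
        exact Finset.sum_congr rfl fun _ _ => by ring
      rw [e3, ← frob_self_eq_sum_sigma, ← frob_self_eq_sum_sigma, ← frob_self_eq_sum_sigma]
      linarith
    have h2 := (Finset.sum_eq_zero_iff_of_nonneg fun i _ => sq_nonneg _).1
      (le_antisymm h1 (Finset.sum_nonneg fun i _ => sq_nonneg _))
    ext i
    have := pow_eq_zero_iff two_ne_zero |>.1 (h2 i (Finset.mem_univ i))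
    simpa [sub_eq_zero] using this
  have bound : ∀ A B : Matrix (Fin m) (Fin n) ℝ,
      frob A (U * Diag (sigma B) * Vᵀ) ≤ ∑ i, sigma A i * sigma B i := by
    intro A B
    obtain ⟨⟨P, Q⟩, hP, hQ, h'⟩ := svdPairs_nonempty A
    calc _ = frob (P * Diag (sigma A) * Qᵀ) (U * Diag (sigma B) * Vᵀ) := by rw [← h']
      _ ≤ _ := frob_le_of_svd hU hV hP hQ (sigma_antitone A) (sigma_antitone B)
        (sigma_nonneg A) (sigma_nonneg B)
  have hWd : X + Y = U * Diag (sigma X) * Vᵀ + U * Diag (sigma Y) * Vᵀ := by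
    rw [← Matrix.add_mul, ← Matrix.mul_add, ← Diag_add, ← hs, ← hW]
  have hW2 : frob (X + Y) (X + Y) = ∑ i, sigma X i * sigma X i + 2 * ∑ i, sigma X i * sigma Y i +
      ∑ i, sigma Y i * sigma Y i := by
    rw [frob_self_eq_sum_sigma, hs]
    simp only [Finset.mul_sum, ← Finset.sum_add_distrib]
    exact Finset.sum_congr rfl fun _ _ => by simp; ring
  -- Each of the four terms is bounded by `bound`, and by `hW2` the bounds add up to the left side,
  -- so all four are equalities.
  have hsplit : frob (X + Y) (X + Y) = frob X (U * Diag (sigma X) * Vᵀ) +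
      frob X (U * Diag (sigma Y) * Vᵀ) + frob Y (U * Diag (sigma X) * Vᵀ) +
      frob Y (U * Diag (sigma Y) * Vᵀ) := by
    nth_rw 2 [hWd]
    rw [frob_add_left, frob_add_right, frob_add_right]; ring
  have hcomm : ∑ i, sigma Y i * sigma X i = ∑ i, sigma X i * sigma Y i :=
    Finset.sum_congr rfl fun _ _ => mul_comm _ _
  have bXX := bound X X
  have bXY := bound X Y
  have bYX := bound Y X
  have bYY := bound Y Y
  have fin : ∀ A : Matrix (Fin m) (Fin n) ℝ,
      ∑ i, sigma A i * sigma A i ≤ frob A (U * Diag (sigma A) * Vᵀ) →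
      (U, V) ∈ svdPairs A := by
    intro A hA
    refine ⟨hU, hV, sub_eq_zero.1 (eq_zero_of_frob_self_nonpos _ ?_)⟩
    dsimp only
    rw [frob_self_sub, frob_orthogonal _ _ hU hV, frob_Diag_Diag, frob_self_eq_sum_sigma]
    linarith
  exact ⟨(U, V), fin X (by linarith), fin Y (by linarith)⟩

/-- The entries of `v` may be signed and unsorted: `f` is symmetric and sees only the squares,
through `√(t ^ 2) = |t|`. -/
theorem f_sigma_orthogonal_Diag (ε : ℝ) {U : Matrix (Fin m) (Fin m) ℝ}
    {V : Matrix (Fin n) (Fin n) ℝ} (hU : Uᵀ * U = 1) (hV : Vᵀ * V = 1)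
    (v : EuclideanSpace ℝ (Fin (min m n))) : f ε (sigma (U * Diag v * Vᵀ)) = f ε v := by
  obtain ⟨⟨P, Q⟩, hP, hQ, h⟩ := svdPairs_nonempty (U * Diag v * Vᵀ)
  have := sum_sq_eq_of_orthogonal_Diag_eq hU hV hP hQ h
    (φ := fun t => Real.log (1 + √t / ε)) (by simp)
  simpa [f, Real.sqrt_sq_eq_abs] using this.symm

theorem norm_sq_orthogonal_Diag_sub {Z : Matrix (Fin m) (Fin n) ℝ} {U : Matrix (Fin m) (Fin m) ℝ}
    {V : Matrix (Fin n) (Fin n) ℝ} (h : (U, V) ∈ svdPairs Z)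
    (v : EuclideanSpace ℝ (Fin (min m n))) :
    ‖U * Diag v * Vᵀ - Z‖ ^ 2 = ‖v - sigma Z‖ ^ 2 := by
  obtain ⟨hU, hV, hZ⟩ := h
  dsimp only at hU hV hZ
  have : U * Diag v * Vᵀ - Z = U * Diag (v - sigma Z) * Vᵀ := by
    rw [Diag_sub, Matrix.mul_sub, Matrix.sub_mul, ← hZ]
  rw [norm_sq_eq_frob, this, frob_orthogonal _ _ hU hV, frob_Diag_Diag, EuclideanSpace.norm_sq_eq]
  simp [sq]

theorem norm_sq_sigma_sub (X Z : Matrix (Fin m) (Fin n) ℝ) :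
    ‖sigma X - sigma Z‖ ^ 2 = frob X X - 2 * ∑ i, sigma X i * sigma Z i + frob Z Z := by
  rw [EuclideanSpace.norm_sq_eq, frob_self_eq_sum_sigma, frob_self_eq_sum_sigma, Finset.mul_sum,
    ← Finset.sum_sub_distrib, ← Finset.sum_add_distrib]
  exact Finset.sum_congr rfl fun _ _ => by simp; ring

theorem norm_sq_sub_eq_frob (X Z : Matrix (Fin m) (Fin n) ℝ) :
    ‖X - Z‖ ^ 2 = frob X X - 2 * frob X Z + frob Z Z := by
  rw [norm_sq_eq_frob, frob_self_sub]

/-- Singular values are nonexpansive for the Frobenius norm. -/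
theorem norm_sq_sigma_sub_le (X Z : Matrix (Fin m) (Fin n) ℝ) :
    ‖sigma X - sigma Z‖ ^ 2 ≤ ‖X - Z‖ ^ 2 := by
  rw [norm_sq_sigma_sub, norm_sq_sub_eq_frob]
  linarith [frob_le_sum_sigma X Z]

end svd

/-! ### Reduction to the vector and scalar problems -/

/-- The objective is separable, so changing one coordinate of a minimizer tests that coordinate
alone. -/
theorem apply_mem_prox_g {k : ℕ} {ε lam : ℝ} {z d : EuclideanSpace ℝ (Fin k)}
    (hd : d ∈ prox lam (f ε) z) (i : Fin k) : d i ∈ prox lam (g ε) (z i) := by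
  intro v
  have h := hd (WithLp.toLp 2 (Function.update d i v))
  simp only [EuclideanSpace.norm_sq_eq, f, Finset.mul_sum, ← Finset.sum_add_distrib] at h
  rw [← Finset.add_sum_erase _ _ (Finset.mem_univ i),
    ← Finset.add_sum_erase _ _ (Finset.mem_univ i)] at h
  have h2 : ∑ j ∈ Finset.univ.erase i, (1 / (2 * lam) *
        ‖(WithLp.toLp 2 (Function.update d i v) - z : EuclideanSpace ℝ (Fin k)) j‖ ^ 2 +
        Real.log (1 + |(WithLp.toLp 2 (Function.update d i v) : EuclideanSpace ℝ (Fin k)) j| / ε)) =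
      ∑ j ∈ Finset.univ.erase i, (1 / (2 * lam) * ‖(d - z) j‖ ^ 2 +
        Real.log (1 + |d j| / ε)) :=
    Finset.sum_congr rfl fun j hj => by simp [Finset.ne_of_mem_erase hj]
  rw [h2] at h
  simpa [g] using le_of_add_le_add_right h

end LogSum

theorem theorem4p1 (m n : ℕ) (Z : Matrix (Fin m) (Fin n) ℝ) (ε lam : ℝ)
    (hε : 0 < ε) (hlam : 0 < lam) :
    (LogSum.prox lam (LogSum.f ε ∘ LogSum.sigma) Z =
      {X : Matrix (Fin m) (Fin n) ℝ | ∀ Y : Matrix (Fin m) (Fin n) ℝ,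
        LogSum.lowRankObjective ε lam Z X ≤ LogSum.lowRankObjective ε lam Z Y}) ∧
    (∀ X ∈ LogSum.prox lam (LogSum.f ε ∘ LogSum.sigma) Z,
      ∃ U : Matrix (Fin m) (Fin m) ℝ, ∃ V : Matrix (Fin n) (Fin n) ℝ,
        (U, V) ∈ LogSum.svdPairs Z ∧
        ∃ d ∈ LogSum.prox lam (LogSum.f ε) (LogSum.sigma Z),
          (∀ i, d i ∈ LogSum.prox lam (LogSum.g ε) (LogSum.sigma Z i)) ∧
          X = U * LogSum.Diag d * V.transpose) ∧
    (∀ U : Matrix (Fin m) (Fin m) ℝ, ∀ V : Matrix (Fin n) (Fin n) ℝ,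
      (U, V) ∈ LogSum.svdPairs Z →
      ∀ d ∈ LogSum.prox lam (LogSum.f ε) (LogSum.sigma Z),
        U * LogSum.Diag d * V.transpose ∈
          LogSum.prox lam (LogSum.f ε ∘ LogSum.sigma) Z) := by
  have hc : 0 < 1 / (2 * lam) := by positivity
  refine ⟨?_, ?_, ?_⟩
  · have h : ∀ X, LogSum.lowRankObjective ε lam Z X =
        1 / (2 * lam) * ‖X - Z‖ ^ 2 + (LogSum.f ε ∘ LogSum.sigma) X := by
      intro X
      simp [LogSum.lowRankObjective, LogSum.norm_sq_eq_frob, LogSum.frob_self_eq_sum_sq, LogSum.f,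
        abs_of_nonneg (LogSum.sigma_nonneg X _)]
    simp only [LogSum.prox, h]
  · intro X hX
    obtain ⟨⟨U, V⟩, hUVX, hUVZ⟩ : (LogSum.svdPairs X ∩ LogSum.svdPairs Z).Nonempty := by
      obtain ⟨⟨U, V⟩, hUV⟩ := LogSum.svdPairs_nonempty Z
      -- This competitor has the penalty of `X`, so minimality compares distances only and gives the
      -- reverse trace inequality.
      have h := hX (U * LogSum.Diag (LogSum.sigma X) * V.transpose)
      rw [Function.comp_apply, Function.comp_apply,
        LogSum.f_sigma_orthogonal_Diag ε hUV.1 hUV.2.1, add_le_add_iff_right,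
        mul_le_mul_iff_right₀ hc, LogSum.norm_sq_orthogonal_Diag_sub hUV,
        LogSum.norm_sq_sigma_sub, LogSum.norm_sq_sub_eq_frob] at h
      exact LogSum.exists_mem_svdPairs_inter_of_le_frob (by linarith)
    have hd : LogSum.sigma X ∈ LogSum.prox lam (LogSum.f ε) (LogSum.sigma Z) := by
      intro v
      have h := hX (U * LogSum.Diag v * V.transpose)
      rw [Function.comp_apply, Function.comp_apply,
        LogSum.f_sigma_orthogonal_Diag ε hUVZ.1 hUVZ.2.1,
        LogSum.norm_sq_orthogonal_Diag_sub hUVZ] at h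
      exact le_trans (add_le_add_left (mul_le_mul_of_nonneg_left
        (LogSum.norm_sq_sigma_sub_le X Z) hc.le) _) h
    exact ⟨U, V, hUVZ, LogSum.sigma X, hd, LogSum.apply_mem_prox_g hd, hUVX.2.2⟩
  · intro U V hUV d hd Y
    rw [Function.comp_apply, Function.comp_apply,
      LogSum.f_sigma_orthogonal_Diag ε hUV.1 hUV.2.1, LogSum.norm_sq_orthogonal_Diag_sub hUV]
    exact (hd (LogSum.sigma Y)).trans (add_le_add_left (mul_le_mul_of_nonneg_left
      (LogSum.norm_sq_sigma_sub_le Y Z) hc.le) _)
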